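/- Let $K$ be a field of characteristic zero (for instance $K=\mathbb{C}$) and let $S=K[x_1,\dots,x_5,y_1,\dots,y_5,z_1,\dots,z_5]$ be the coordinate ring of $\mathbb{P}^{14}$. For $1\le i<j<k\le 5$ let $\Delta_{ijk}$ be the $3\times 3$ minor on the columns $i,j,k$ of the generic matrix $$M=\begin{pmatrix} x_1&x_2&x_3&x_4&x_5\\ y_1&y_2&y_3&y_4&y_5\\ z_1&z_2&z_3&z_4&z_5\end{pmatrix},$$ and put $f_1=\Delta_{123}$, $f_2=\Delta_{124}$, $f_3=\Delta_{134}$, $f_4=\Delta_{234}$, $f_5=\Delta_{125}$, $f_6=\Delta_{135}$, $f_7=\Delta_{235}$, $f_8=\Delta_{145}$, $f_9=\Delta_{245}$. A reduced hypersurface in $\mathbb{P}^n$ given by a homogeneous polynomial $F$ of degree $d$ is called free with exponents $d_1\le\dots\le d_n$ if its Milnor algebra $M(F)=S/J_F$, where $J_F$ is the ideal generated by the partial derivatives of $F$, has a minimal graded free resolution of the form $$0\to\bigoplus_{i=1}^{n}S(-d_i-(d-1))\to S^{n+1}(-(d-1))\xrightarrow{\ \nabla F\ }S\to M(F)\to 0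 ,$$ where $\nabla F$ sends $(a_v)_v$ to $\sum_v a_v\,\partial F/\partial v$, with $v$ running over the $n+1$ variables. **Theorem.** For every $k\in\{6,7,8,9\}$ the polynomials $f_1,f_2,f_3,f_4,f_5,f_k$ are homogeneous, irreducible and pairwise without common factor, and the hypersurface arrangement $\mathcal{H}_k: Q_k=f_1f_2f_3f_4f_5f_k=0$ in $\mathbb{P}^{14}$ is reduced and free with exponents $(\underbrace{1,\dots,1}_{13\text{ times}},4)$. -/

import Mathlib

open MvPolynomial

noncomputable section

namespace FreeArrangement

/-! ### Hypersurface arrangements and their freeness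

`σ` is the finite set of homogeneous coordinates of a projective space and
`S = MvPolynomial σ K` is its coordinate ring. -/

/-- The polynomials `f i`, `i ∈ s`, define an arrangement of reduced and irreducible
hypersurfaces: they are homogeneous, irreducible, and pairwise without common factor. -/
structure IsArrangement {ι σ K : Type*} [Field K] (s : Finset ι)
    (f : ι → MvPolynomial σ K) : Prop where
  homogeneous : ∀ i ∈ s, ∃ e : ℕ, (f i).IsHomogeneous e
  irreducible : ∀ i ∈ s, Irreducible (f i)
  relPrime : ∀ i ∈ s, ∀ j ∈ s, i ≠ j → IsRelPrime (f i) (f j)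

/-- The Jacobian ideal `J_F`, generated by all partial derivatives of `F`. -/
def jacobianIdeal {σ K : Type*} [Field K] (F : MvPolynomial σ K) :
    Ideal (MvPolynomial σ K) :=
  Ideal.span (Set.range fun v : σ => pderiv v F)

/-- The Milnor algebra `M(F) = S / J_F`. -/
abbrev MilnorAlgebra {σ K : Type*} [Field K] (F : MvPolynomial σ K) : Type _ :=
  MvPolynomial σ K ⧸ jacobianIdeal F

/-- The map `S^σ → S`, `a ↦ ∑ v, a v * ∂F/∂v`. Its kernel is the module `AR(F)` of Jacobian
syzygies, that is, the module `D₀` of derivations killing `F`. -/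
def gradientMap {σ K : Type*} [Fintype σ] [Field K] (F : MvPolynomial σ K) :
    (σ → MvPolynomial σ K) →ₗ[MvPolynomial σ K] MvPolynomial σ K :=
  Fintype.linearCombination (MvPolynomial σ K) fun v : σ => pderiv v F

/-- `p` belongs to the component of degree `t` of the twisted module `S(-b)`: it is a
homogeneous polynomial of degree `t - b`, and it is zero if `t < b`. -/
def InTwist {σ K : Type*} [Field K] (b t : ℕ) (p : MvPolynomial σ K) : Prop :=
  (b ≤ t → p.IsHomogeneous (t - b)) ∧ (t < b → p = 0)

/-- The linear map `φ` is a homomorphism of degree `0` of graded `S`-modules from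
`⨁ i, S(-a i)` to `⨁ j, S(-b j)`: the generator number `i`, which has degree `a i`, goes to an
element of degree `a i`. -/
def IsGradedHom {ι κ σ K : Type*} [DecidableEq ι] [Field K] (a : ι → ℕ) (b : κ → ℕ)
    (φ : (ι → MvPolynomial σ K) →ₗ[MvPolynomial σ K] (κ → MvPolynomial σ K)) : Prop :=
  ∀ i j, InTwist (b j) (a i) (φ (Pi.single i 1) j)

/-- The sequence
`0 → ⨁ i, S(-d i - (e - 1)) --φ--> S(-(e - 1))^(n+1) --∇F--> S → M(F) → 0`
is a minimal graded free resolution of the Milnor algebra of the form `F` of degree `e`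
(the last map is the quotient map, which is surjective). -/
structure IsShortMilnorResolution {n : ℕ} {σ K : Type*} [Fintype σ] [Field K]
    (F : MvPolynomial σ K) (e : ℕ) (d : Fin n → ℕ)
    (φ : (Fin n → MvPolynomial σ K) →ₗ[MvPolynomial σ K] (σ → MvPolynomial σ K)) : Prop where
  graded_left : IsGradedHom (fun i => d i + (e - 1)) (fun _ : σ => e - 1) φ
  graded_right : ∀ v : σ, InTwist 0 (e - 1) (pderiv v F)
  injective : Function.Injective φ
  exact_middle : Function.Exact φ (gradientMap F)
  exact_right : Function.Exact (gradientMap F) (Submodule.mkQ (jacobianIdeal F))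
  minimal_left : ∀ i v, constantCoeff (φ (Pi.single i 1) v) = 0
  minimal_right : ∀ v : σ, constantCoeff (pderiv v F) = 0

/-- The hypersurface `F = 0` in projective `n`-space (with `n + 1` homogeneous coordinates) is
reduced, and it is free with exponents `d 0 ≤ d 1 ≤ ⋯ ≤ d (n-1)`. -/
def IsFreeWithExponents {n : ℕ} {σ K : Type*} [Fintype σ] [Field K]
    (F : MvPolynomial σ K) (d : Fin n → ℕ) : Prop :=
  Fintype.card σ = n + 1 ∧ Squarefree F ∧ Monotone d ∧
    ∃ e : ℕ, 0 < e ∧ F.IsHomogeneous e ∧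
      ∃ φ : (Fin n → MvPolynomial σ K) →ₗ[MvPolynomial σ K] (σ → MvPolynomial σ K),
        IsShortMilnorResolution F e d φ

/-! ### The minors of the generic `3 × 5` matrix -/

/-- The fifteen indeterminates: `(0, c)`, `(1, c)`, `(2, c)` stand for `x`, `y`, `z` with
index `c + 1`. -/
abbrev Var : Type := Fin 3 × Fin 5

/-- The generic `3 × 5` matrix with rows `x`, `y`, `z`. -/
def genericMatrix (K : Type*) [Field K] : Matrix (Fin 3) (Fin 5) (MvPolynomial Var K) :=
  Matrix.of fun r c => X (r, c)

/-- The `3`-minor of the generic matrix on the columns number `i`, `j`, `k`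
(counted from zero). -/
def minor (K : Type*) [Field K] (i j k : Fin 5) : MvPolynomial Var K :=
  ((genericMatrix K).submatrix id ![i, j, k]).det

/-- The ten maximal minors, numbered from `1` to `10` (other indices are not used). -/
def f (K : Type*) [Field K] : ℕ → MvPolynomial Var K
  | 1 => minor K 0 1 2
  | 2 => minor K 0 1 3
  | 3 => minor K 0 2 3
  | 4 => minor K 1 2 3
  | 5 => minor K 0 1 4
  | 6 => minor K 0 2 4
  | 7 => minor K 1 2 4
  | 8 => minor K 0 3 4
  | 9 => minor K 1 3 4
  | 10 => minor K 2 3 4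
  | _ => 0

/-- The defining polynomial `Q_k = f₁ f₂ f₃ f₄ f₅ f_k`. -/
def Q (K : Type*) [Field K] (k : ℕ) : MvPolynomial Var K :=
  f K 1 * f K 2 * f K 3 * f K 4 * f K 5 * f K k

end FreeArrangement

end

/-! A permutation of the columns turns `Q K k`, up to sign, into the product of the minors 012, 013,
023, 123, 014, 024 of columns `v 0`, …, `v 4`, so one product is enough. Its Jacobian syzygies are
the derivations `D` that kill it, and these can be written down explicitly.

The minors are irreducible and pairwise coprime, so `D` carries each one to a multiple of itself.
Differentiating the linear relation between `v 0`, …, `v 3`, whose coefficients are the first four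
minors, shows that on these columns `D` is a row operation `B` plus a scaling of `v 1`, `v 2`, `v 3`
(`exists_mulVec_add_smul`). The minors 014 and 024 then force `D (v 4) - B (v 4)` to be a
combination of `v 0`, `v 2`, `v 4` in which the coefficient of `v 2` is divisible by the minor 014
(`exists_combination`).

The condition `D Q = 0` is one linear equation on the parameters, and it determines the scaling of
`v 4`, since 2 is invertible. What remains free is 9 entries of `B`, 3 scalings, the coefficient of
`v 0` and the quotient of the coefficient of `v 2` by the minor 014. The first 13 parameters give
linear fields and the last a field of degree 3 + 1 = 4. The 14 fields are independent
(`eq_zero_of_logField_eq_zero`), hence form a basis of the syzygies. -/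

namespace FreeArrangement

open Matrix

/-! ### Identities for 3 × 3 determinants -/

section TripleProduct

variable {R : Type*} [CommRing R]

/-- The determinant of the `3 × 3` matrix with columns `u`, `v`, `w`. -/
def triple (u v w : Fin 3 → R) : R :=
  u 0 * (v 1 * w 2 - v 2 * w 1) - u 1 * (v 0 * w 2 - v 2 * w 0) + u 2 * (v 0 * w 1 - v 1 * w 0)

/-- Cramer's rule, cleared of denominators. -/
theorem triple_mul_apply (a b c x : Fin 3 → R) (r : Fin 3) :
    triple a b c * x r = triple x b c * a r + triple a x c * b r + triple a b x * c r := by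
  fin_cases r <;> simp only [triple, Fin.zero_eta, Fin.mk_one, Fin.reduceFinMk] <;> ring

theorem mulVec_three (B : Matrix (Fin 3) (Fin 3) R) (v : Fin 3 → R) (r : Fin 3) :
    (B *ᵥ v) r = B r 0 * v 0 + B r 1 * v 1 + B r 2 * v 2 := by
  simp [Matrix.mulVec, dotProduct, Fin.sum_univ_three]

/-- The derivative of `det (1 + t B)` at `t = 0` is the trace: this is why row operations are
logarithmic for every minor at once. -/
theorem triple_mulVec (B : Matrix (Fin 3) (Fin 3) R) (u v w : Fin 3 → R) :
    triple (B *ᵥ u) v w + triple u (B *ᵥ v) w + triple u v (B *ᵥ w) = B.trace * triple u v w := by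
  simp only [triple, mulVec_three, Matrix.trace_fin_three]
  ring

theorem derivation_triple {K : Type*} [CommRing K] [Algebra K R] (D : Derivation K R R)
    (u v w : Fin 3 → R) :
    D (triple u v w) = triple (D ∘ u) v w + triple u (D ∘ v) w + triple u v (D ∘ w) := by
  simp only [triple, map_add, map_sub, Derivation.leibniz, smul_eq_mul, Function.comp_apply]
  ring

theorem mul_eq_zero_of_combination_eq_zero {a b : Fin 3 → R} {x y : R} (c : Fin 3 → R)
    (h : ∀ r, x * a r + y * b r = 0) : x * triple a b c = 0 ∧ y * triple a b c = 0 := by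
  have h0 := h 0
  have h1 := h 1
  have h2 := h 2
  simp only [triple]
  constructor
  · linear_combination (b 1 * c 2 - b 2 * c 1) * h0 - (b 0 * c 2 - b 2 * c 0) * h1
      + (b 0 * c 1 - b 1 * c 0) * h2
  · linear_combination -(a 1 * c 2 - a 2 * c 1) * h0 + (a 0 * c 2 - a 2 * c 0) * h1
      - (a 0 * c 1 - a 1 * c 0) * h2

/-- The matrix that sends `a`, `b`, `c` to the multiples by `triple a b c` of `x`, `y`, `z`. -/
def cramerMatrix (a b c x y z : Fin 3 → R) : Matrix (Fin 3) (Fin 3) R :=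
  Matrix.of fun r s => triple (Pi.single s 1) b c * x r + triple a (Pi.single s 1) c * y r
    + triple a b (Pi.single s 1) * z r

theorem cramerMatrix_mulVec (a b c x y z v : Fin 3 → R) (r : Fin 3) :
    (cramerMatrix a b c x y z *ᵥ v) r
      = triple v b c * x r + triple a v c * y r + triple a b v * z r := by
  rw [mulVec_three]
  simp [cramerMatrix, triple]
  ring

theorem triple_same_left (a c : Fin 3 → R) : triple a a c = 0 := by simp only [triple]; ring

theorem triple_same_right (a c : Fin 3 → R) : triple c a a = 0 := by simp only [triple]; ring

theorem triple_same_outer (a c : Fin 3 → R) : triple a c a = 0 := by simp only [triple]; ring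

/-- Three-term Plücker relations, used to compare Cramer matrices built on two different triples of
columns. -/
theorem triple_plucker (a b c d x : Fin 3 → R) :
    triple a b d * triple x b c = triple a b c * triple x b d + triple a b x * triple b c d := by
  simp only [triple]; ring

theorem triple_plucker' (a b c d x : Fin 3 → R) :
    triple a b d * triple a x c = triple a b c * triple a x d - triple a b x * triple a c d := by
  simp only [triple]; ring

theorem triple_comm_right (a b c : Fin 3 → R) : triple a c b = -triple a b c := by
  simp only [triple]; ring

theorem triple_comm_left (a b c : Fin 3 → R) : triple b a c = -triple a b c := by
  simp only [triple]; ring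

end TripleProduct

/-! ### Divisibility arguments: from logarithmic derivations to row and column operations -/

section Domain

variable {R : Type*} [CommRing R] [DecompositionMonoid R]

theorem exists_eq_mul_of_mul_eq_mul {x y a b : R} (hrel : IsRelPrime x y) (h : y * a = x * b) :
    ∃ z, a = x * z :=
  hrel.dvd_of_dvd_mul_left ⟨b, h⟩

/-- By the Leibniz rule `p` divides `g * D p`, and it has no common factor with `g`. -/
theorem dvd_derivation_of_derivation_mul_eq_zero {K : Type*} [CommRing K] [Algebra K R]
    (D : Derivation K R R) {p g : R} (hrel : IsRelPrime p g) (h : D (p * g) = 0) :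
    ∃ m, D p = m * p := by
  rw [Derivation.leibniz, smul_eq_mul, smul_eq_mul] at h
  obtain ⟨m, hm⟩ := exists_eq_mul_of_mul_eq_mul hrel (a := D p) (b := -D g)
    (by linear_combination h)
  exact ⟨m, by rw [hm, mul_comm]⟩


variable [IsDomain R]

/-- If `w₁, …, w₄` satisfy the linear relation between `v₁, …, v₄`, then they are the images of
these vectors under one matrix. -/
theorem exists_mulVec_eq {v₁ v₂ v₃ v₄ w₁ w₂ w₃ w₄ : Fin 3 → R}
    (h₁ : triple v₁ v₂ v₃ ≠ 0) (hrel : IsRelPrime (triple v₁ v₂ v₃) (triple v₁ v₂ v₄))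
    (h : ∀ r, triple v₁ v₂ v₃ * w₄ r
      = triple v₂ v₃ v₄ * w₁ r - triple v₁ v₃ v₄ * w₂ r + triple v₁ v₂ v₄ * w₃ r) :
    ∃ B : Matrix (Fin 3) (Fin 3) R,
      B *ᵥ v₁ = w₁ ∧ B *ᵥ v₂ = w₂ ∧ B *ᵥ v₃ = w₃ ∧ B *ᵥ v₄ = w₄ := by
  -- Over the fraction field the matrix is unique. Solved from `v₁, v₂, v₃` it has denominator
  -- `triple v₁ v₂ v₃`, solved from `v₁, v₂, v₄` it has denominator `triple v₁ v₂ v₄`; these are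
  -- coprime, so its entries lie in `R`.
  have key (r s : Fin 3) : ∃ z, cramerMatrix v₁ v₂ v₃ w₁ w₂ w₃ r s = triple v₁ v₂ v₃ * z := by
    refine exists_eq_mul_of_mul_eq_mul (b := cramerMatrix v₁ v₂ v₄ w₁ w₂ w₄ r s) hrel ?_
    simp only [cramerMatrix, Matrix.of_apply]
    generalize (Pi.single s 1 : Fin 3 → R) = x
    linear_combination w₁ r * triple_plucker v₁ v₂ v₃ v₄ x
      + w₂ r * triple_plucker' v₁ v₂ v₃ v₄ x - triple v₁ v₂ x * h r
  choose B hB using key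
  have hmul (v : Fin 3 → R) (r : Fin 3) : triple v₁ v₂ v₃ * (Matrix.of B *ᵥ v) r
      = triple v v₂ v₃ * w₁ r + triple v₁ v v₃ * w₂ r + triple v₁ v₂ v * w₃ r := by
    rw [← cramerMatrix_mulVec, mulVec_three, mulVec_three]
    simp only [hB, Matrix.of_apply]
    ring
  refine ⟨Matrix.of B, ?_, ?_, ?_, ?_⟩ <;> funext r <;> apply mul_left_cancel₀ h₁ <;> rw [hmul]
  · rw [triple_same_left, triple_same_outer]; ring
  · rw [triple_same_left, triple_same_right]; ring
  · rw [triple_same_right, triple_same_outer]; ring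
  · rw [h]; simp only [triple]; ring

/-- The logarithmic derivations of the four maximal minors of a `3 × 4` matrix come from row
operations and scalings of columns. -/
theorem exists_mulVec_add_smul {K : Type*} [CommRing K] [Algebra K R] (D : Derivation K R R)
    {v₁ v₂ v₃ v₄ : Fin 3 → R} {m₁ m₂ m₃ m₄ : R}
    (h₁ : triple v₁ v₂ v₃ ≠ 0) (hrel : IsRelPrime (triple v₁ v₂ v₃) (triple v₁ v₂ v₄))
    (hm₁ : D (triple v₁ v₂ v₃) = m₁ * triple v₁ v₂ v₃)
    (hm₂ : D (triple v₁ v₂ v₄) = m₂ * triple v₁ v₂ v₄)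
    (hm₃ : D (triple v₁ v₃ v₄) = m₃ * triple v₁ v₃ v₄)
    (hm₄ : D (triple v₂ v₃ v₄) = m₄ * triple v₂ v₃ v₄) :
    ∃ (B : Matrix (Fin 3) (Fin 3) R) (c₂ c₃ c₄ : R),
      D ∘ v₁ = B *ᵥ v₁ ∧ D ∘ v₂ = B *ᵥ v₂ + c₂ • v₂ ∧ D ∘ v₃ = B *ᵥ v₃ + c₃ • v₃ ∧
        D ∘ v₄ = B *ᵥ v₄ + c₄ • v₄ := by
  -- Apply `D` to the relation between the `vᵢ` and subtract `m₄` times the relation. The corrected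
  -- images satisfy the same relation, and `v₁` needs no correction.
  obtain ⟨B, hB₁, hB₂, hB₃, hB₄⟩ := exists_mulVec_eq (w₁ := D ∘ v₁)
    (w₂ := D ∘ v₂ - (m₄ - m₃) • v₂) (w₃ := D ∘ v₃ - (m₄ - m₂) • v₃)
    (w₄ := D ∘ v₄ - (m₄ - m₁) • v₄) h₁ hrel (fun r => by
      have hr : triple v₁ v₂ v₃ * v₄ r
          = triple v₂ v₃ v₄ * v₁ r - triple v₁ v₃ v₄ * v₂ r + triple v₁ v₂ v₄ * v₃ r := by
        rw [triple_mul_apply]; simp only [triple]; ring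
      have hD := congrArg D hr
      simp only [map_add, map_sub, Derivation.leibniz, smul_eq_mul, hm₁, hm₂, hm₃, hm₄] at hD
      simp only [Pi.sub_apply, Function.comp_apply, Pi.smul_apply, smul_eq_mul]
      linear_combination hD - m₄ * hr)
  refine ⟨B, m₄ - m₃, m₄ - m₂, m₄ - m₁, hB₁.symm, ?_, ?_, ?_⟩
  · rw [hB₂]; abel
  · rw [hB₃]; abel
  · rw [hB₄]; abel

/-- The vector `u - n • v₅` is coplanar with `v₁` and `v₃`. Its coordinates there, found with the
help of `v₂` or of `v₄`, have two coprime denominators, so they lie in `R`; pairing with `v₁, v₂`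
then yields the factor `triple v₁ v₂ v₅`. -/
theorem exists_combination {v₁ v₂ v₃ v₄ v₅ u : Fin 3 → R} {m n : R}
    (h₁ : triple v₁ v₂ v₃ ≠ 0)
    (hrel : IsRelPrime (triple v₁ v₂ v₃) (triple v₁ v₃ v₄))
    (hrel' : IsRelPrime (triple v₁ v₂ v₅) (triple v₁ v₂ v₃))
    (hm : triple v₁ v₂ u = m * triple v₁ v₂ v₅) (hn : triple v₁ v₃ u = n * triple v₁ v₃ v₅) :
    ∃ c p q : R, u = p • v₁ + (q * triple v₁ v₂ v₅) • v₃ + c • v₅ := by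
  obtain ⟨x, hx⟩ : ∃ x, x = u - n • v₅ := ⟨_, rfl⟩
  have hx₀ : triple v₁ v₃ x = 0 := by
    have : triple v₁ v₃ x = triple v₁ v₃ u - n * triple v₁ v₃ v₅ := by
      simp [hx, triple]; ring
    rw [this, hn, sub_self]
  have hx₂ : triple v₁ v₂ x = (m - n) * triple v₁ v₂ v₅ := by
    have : triple v₁ v₂ x = triple v₁ v₂ u - n * triple v₁ v₂ v₅ := by
      simp [hx, triple]; ring
    rw [this, hm]; ring
  have ha (r) : triple v₁ v₂ v₃ * x r = triple x v₂ v₃ * v₁ r + triple v₁ v₂ x * v₃ r := by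
    rw [triple_mul_apply, triple_comm_right v₁ v₃ x, hx₀]; ring
  have hb (r) : triple v₁ v₃ v₄ * x r = triple x v₃ v₄ * v₁ r + triple v₁ x v₄ * v₃ r := by
    rw [triple_mul_apply, hx₀]; ring
  have hc := mul_eq_zero_of_combination_eq_zero (a := v₁) (b := v₃)
    (x := triple v₁ v₃ v₄ * triple x v₂ v₃ - triple v₁ v₂ v₃ * triple x v₃ v₄)
    (y := triple v₁ v₃ v₄ * triple v₁ v₂ x - triple v₁ v₂ v₃ * triple v₁ x v₄) v₂
    fun r => by linear_combination triple v₁ v₂ v₃ * hb r - triple v₁ v₃ v₄ * ha r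
  rw [triple_comm_right v₁ v₂ v₃] at hc
  simp only [mul_neg, neg_eq_zero, mul_eq_zero, h₁, or_false] at hc
  obtain ⟨p, hp⟩ := exists_eq_mul_of_mul_eq_mul hrel (sub_eq_zero.mp hc.1)
  obtain ⟨q, hq⟩ := exists_eq_mul_of_mul_eq_mul hrel (sub_eq_zero.mp hc.2)
  obtain ⟨q', hq'⟩ : triple v₁ v₂ v₅ ∣ q :=
    hrel'.dvd_of_dvd_mul_left ⟨m - n, by rw [← hq, hx₂, mul_comm]⟩
  refine ⟨n, p, q', ?_⟩
  have hxr : x = p • v₁ + (q' * triple v₁ v₂ v₅) • v₃ := by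
    funext r
    apply mul_left_cancel₀ h₁
    rw [ha, hp, hq, hq']
    simp only [Pi.add_apply, Pi.smul_apply, smul_eq_mul]
    ring
  rw [← hxr, hx]; abel

end Domain

/-! ### The explicit fields kill the product -/

section LogField

variable {R : Type*} [CommRing R]

/-- The matrix of row operations encoded by the first nine parameters. -/
def paramMatrix (c : Fin 14 → R) : Matrix (Fin 3) (Fin 3) R :=
  !![c 0, c 1, c 2; c 3, c 4, c 5; c 6, c 7, c 8]

/-- The vector field with parameters `c` on the space of `3 × 5` matrices with columns `v`;
`h` plays the part of `1 / 2`. -/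
def logField (h : R) (v : Fin 5 → Fin 3 → R) (c : Fin 14 → R) (i : Fin 5) : Fin 3 → R :=
  paramMatrix c *ᵥ v i + ![0, c 9 • v 1, c 10 • v 2, c 11 • v 3,
    c 12 • v 0 + (c 13 * triple (v 0) (v 1) (v 4)) • v 2
      + (-h * (6 * (paramMatrix c).trace + 4 * c 9 + 4 * c 10 + 3 * c 11
          + c 13 * triple (v 0) (v 1) (v 2))) • v 4] i

/-- The product of the minors `012`, `013`, `023`, `123`, `014`, `024`. -/
def tripleProd (v : Fin 5 → Fin 3 → R) : R :=
  triple (v 0) (v 1) (v 2) * triple (v 0) (v 1) (v 3) * triple (v 0) (v 2) (v 3)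
    * triple (v 1) (v 2) (v 3) * triple (v 0) (v 1) (v 4) * triple (v 0) (v 2) (v 4)

theorem triple_add_smul {B : Matrix (Fin 3) (Fin 3) R} {u v w : Fin 3 → R} (a b c : R)
    {u' v' w' : Fin 3 → R} (hu : u' = B *ᵥ u + a • u) (hv : v' = B *ᵥ v + b • v)
    (hw : w' = B *ᵥ w + c • w) :
    triple u' v w + triple u v' w + triple u v w' = (B.trace + a + b + c) * triple u v w := by
  have := triple_mulVec B u v w
  subst hu hv hw
  simp only [triple, Pi.add_apply, Pi.smul_apply, smul_eq_mul] at this ⊢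
  linear_combination this

/-- Each minor is an eigenvector, and the eigenvalues sum to zero. The weights 6, 4, 4, 3 in
`logField` count the minors, and those through columns 1, 2, 3; column 4 lies in two, whence the `1
/ 2`. The `c 13` term contributes only through the minor 014, and the `c 12` term not at all. -/
theorem derivation_tripleProd_eq_zero {K : Type*} [CommRing K] [Algebra K R]
    (D : Derivation K R R) {h : R} (hh : 2 * h = 1) {v : Fin 5 → Fin 3 → R} {c : Fin 14 → R}
    (hD : ∀ i, D ∘ v i = logField h v c i) : D (tripleProd v) = 0 := by
  obtain ⟨B, hB⟩ : ∃ B, B = paramMatrix c := ⟨_, rfl⟩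
  obtain ⟨c₅, hc₅⟩ : ∃ c₅, c₅ = -h * (6 * B.trace + 4 * c 9 + 4 * c 10 + 3 * c 11
          + c 13 * triple (v 0) (v 1) (v 2)) := ⟨_, rfl⟩
  have h0 : D ∘ v 0 = B *ᵥ v 0 + (0 : R) • v 0 := by rw [hD, hB]; simp [logField]
  have h1 : D ∘ v 1 = B *ᵥ v 1 + c 9 • v 1 := by rw [hD, hB]; simp [logField]
  have h2 : D ∘ v 2 = B *ᵥ v 2 + c 10 • v 2 := by rw [hD, hB]; simp [logField]
  have h3 : D ∘ v 3 = B *ᵥ v 3 + c 11 • v 3 := by rw [hD, hB]; simp [logField]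
  have h4 : D ∘ v 4 = (B *ᵥ v 4 + c₅ • v 4)
      + (c 12 • v 0 + (c 13 * triple (v 0) (v 1) (v 4)) • v 2) := by
    rw [hD, hc₅, hB]; simp [logField]; abel
  have e012 := (derivation_triple D _ _ _).trans (triple_add_smul _ _ _ h0 h1 h2)
  have e013 := (derivation_triple D _ _ _).trans (triple_add_smul _ _ _ h0 h1 h3)
  have e023 := (derivation_triple D _ _ _).trans (triple_add_smul _ _ _ h0 h2 h3)
  have e123 := (derivation_triple D _ _ _).trans (triple_add_smul _ _ _ h1 h2 h3)
  have hadd (a b u w : Fin 3 → R) : triple a b (u + w) = triple a b u + triple a b w := by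
    simp only [triple, Pi.add_apply]; ring
  have e014 : D (triple (v 0) (v 1) (v 4))
      = (B.trace + 0 + c 9 + c₅ + c 13 * triple (v 0) (v 1) (v 2))
          * triple (v 0) (v 1) (v 4) := by
    rw [derivation_triple, h4, hadd, ← add_assoc, triple_add_smul _ _ _ h0 h1 rfl]
    simp only [triple, Pi.add_apply, Pi.smul_apply, smul_eq_mul]; ring
  have e024 : D (triple (v 0) (v 2) (v 4))
      = (B.trace + 0 + c 10 + c₅) * triple (v 0) (v 2) (v 4) := by
    rw [derivation_triple, h4, hadd, ← add_assoc, triple_add_smul _ _ _ h0 h2 rfl]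
    simp only [triple, Pi.add_apply, Pi.smul_apply, smul_eq_mul]; ring
  simp only [tripleProd, Derivation.leibniz, smul_eq_mul, e012, e013, e023, e123, e014, e024]
  have hc : 6 * B.trace + 4 * c 9 + 4 * c 10 + 3 * c 11 + 2 * c₅
      + c 13 * triple (v 0) (v 1) (v 2) = 0 := by
    rw [hc₅]
    linear_combination -(6 * B.trace + 4 * c 9 + 4 * c 10 + 3 * c 11
      + c 13 * triple (v 0) (v 1) (v 2)) * hh
  generalize triple (v 0) (v 1) (v 2) = f₁ at *
  generalize triple (v 0) (v 1) (v 3) = f₂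
  generalize triple (v 0) (v 2) (v 3) = f₃
  generalize triple (v 1) (v 2) (v 3) = f₄
  generalize triple (v 0) (v 1) (v 4) = f₅
  generalize triple (v 0) (v 2) (v 4) = f₆
  linear_combination f₁ * f₂ * f₃ * f₄ * f₅ * f₆ * hc

end LogField

/-! ### The explicit fields generate and are independent -/

section LogFieldDomain

variable {R : Type*} [CommRing R]

/-- The conditions on the six minors under which the vector fields `logField` form a basis of
the derivations killing their product. -/
structure IsGenericColumns (v : Fin 5 → Fin 3 → R) : Prop where
  ne_zero : tripleProd v ≠ 0
  relPrime₁ : IsRelPrime (triple (v 0) (v 1) (v 2))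
    (triple (v 0) (v 1) (v 3) * triple (v 0) (v 2) (v 3) * triple (v 1) (v 2) (v 3)
      * triple (v 0) (v 1) (v 4) * triple (v 0) (v 2) (v 4))
  relPrime₂ : IsRelPrime (triple (v 0) (v 1) (v 3))
    (triple (v 0) (v 1) (v 2) * triple (v 0) (v 2) (v 3) * triple (v 1) (v 2) (v 3)
      * triple (v 0) (v 1) (v 4) * triple (v 0) (v 2) (v 4))
  relPrime₃ : IsRelPrime (triple (v 0) (v 2) (v 3))
    (triple (v 0) (v 1) (v 2) * triple (v 0) (v 1) (v 3) * triple (v 1) (v 2) (v 3)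
      * triple (v 0) (v 1) (v 4) * triple (v 0) (v 2) (v 4))
  relPrime₄ : IsRelPrime (triple (v 1) (v 2) (v 3))
    (triple (v 0) (v 1) (v 2) * triple (v 0) (v 1) (v 3) * triple (v 0) (v 2) (v 3)
      * triple (v 0) (v 1) (v 4) * triple (v 0) (v 2) (v 4))
  relPrime₅ : IsRelPrime (triple (v 0) (v 1) (v 4))
    (triple (v 0) (v 1) (v 2) * triple (v 0) (v 1) (v 3) * triple (v 0) (v 2) (v 3)
      * triple (v 1) (v 2) (v 3) * triple (v 0) (v 2) (v 4))
  relPrime₆ : IsRelPrime (triple (v 0) (v 2) (v 4))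
    (triple (v 0) (v 1) (v 2) * triple (v 0) (v 1) (v 3) * triple (v 0) (v 2) (v 3)
      * triple (v 1) (v 2) (v 3) * triple (v 0) (v 1) (v 4))

variable [IsDomain R]

theorem exists_logField_eq [DecompositionMonoid R] {K : Type*} [CommRing K] [Algebra K R]
    (D : Derivation K R R)
    {h : R} (hh : 2 * h = 1) {v : Fin 5 → Fin 3 → R} (hv : IsGenericColumns v)
    (hD : D (tripleProd v) = 0) : ∃ c, ∀ i, D ∘ v i = logField h v c i := by
  obtain ⟨m₁, hm₁⟩ := dvd_derivation_of_derivation_mul_eq_zero D hv.relPrime₁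
    (by rw [← hD]; simp only [tripleProd]; congr 1; ring)
  obtain ⟨m₂, hm₂⟩ := dvd_derivation_of_derivation_mul_eq_zero D hv.relPrime₂
    (by rw [← hD]; simp only [tripleProd]; congr 1; ring)
  obtain ⟨m₃, hm₃⟩ := dvd_derivation_of_derivation_mul_eq_zero D hv.relPrime₃
    (by rw [← hD]; simp only [tripleProd]; congr 1; ring)
  obtain ⟨m₄, hm₄⟩ := dvd_derivation_of_derivation_mul_eq_zero D hv.relPrime₄
    (by rw [← hD]; simp only [tripleProd]; congr 1; ring)
  obtain ⟨m₅, hm₅⟩ := dvd_derivation_of_derivation_mul_eq_zero D hv.relPrime₅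
    (by rw [← hD]; simp only [tripleProd]; congr 1; ring)
  obtain ⟨m₆, hm₆⟩ := dvd_derivation_of_derivation_mul_eq_zero D hv.relPrime₆
    (by rw [← hD]; simp only [tripleProd]; congr 1; ring)
  have hne := hv.ne_zero
  simp only [tripleProd, mul_ne_zero_iff] at hne
  obtain ⟨⟨⟨⟨⟨n₁, n₂⟩, n₃⟩, n₄⟩, n₅⟩, n₆⟩ := hne
  have hr := hv.relPrime₁
  simp only [IsRelPrime.mul_right_iff] at hr
  obtain ⟨⟨⟨⟨hr₂, hr₃⟩, -⟩, hr₅⟩, -⟩ := hr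
  obtain ⟨B, c₂, c₃, c₄, h0, h1, h2, h3⟩ := exists_mulVec_add_smul D n₁ hr₂ hm₁ hm₂ hm₃ hm₄
  have h0' : D ∘ v 0 = B *ᵥ v 0 + (0 : R) • v 0 := by rw [h0]; simp
  obtain ⟨u, hu⟩ : ∃ u, u = D ∘ v 4 - B *ᵥ v 4 := ⟨_, rfl⟩
  have hsub (a b : Fin 3 → R) : triple a b (D ∘ v 4) = triple a b (B *ᵥ v 4 + (0 : R) • v 4)
      + triple a b u := by
    simp only [hu, triple, Pi.add_apply, Pi.sub_apply, Pi.smul_apply, smul_eq_mul]; ring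
  obtain ⟨c₅, p, q, hcomb⟩ := exists_combination (u := u) (v₅ := v 4) (v₄ := v 3)
    (m := m₅ - B.trace - c₂) (n := m₆ - B.trace - c₃) n₁ hr₃ hr₅.symm
    (by
      rw [derivation_triple, hsub, ← add_assoc, triple_add_smul _ _ _ h0' h1 rfl] at hm₅
      linear_combination hm₅)
    (by
      rw [derivation_triple, hsub, ← add_assoc, triple_add_smul _ _ _ h0' h2 rfl] at hm₆
      linear_combination hm₆)
  have h4 : D ∘ v 4 = B *ᵥ v 4
      + (p • v 0 + (q * triple (v 0) (v 1) (v 4)) • v 2 + c₅ • v 4) := by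
    rw [← hcomb, hu]; abel
  have hadd (a b u w : Fin 3 → R) : triple a b (u + w) = triple a b u + triple a b w := by
    simp only [triple, Pi.add_apply]; ring
  have h4' : D ∘ v 4 = (B *ᵥ v 4 + c₅ • v 4)
      + (p • v 0 + (q * triple (v 0) (v 1) (v 4)) • v 2) := by
    rw [h4]; abel
  have e012 := (derivation_triple D _ _ _).trans (triple_add_smul _ _ _ h0' h1 h2)
  have e013 := (derivation_triple D _ _ _).trans (triple_add_smul _ _ _ h0' h1 h3)
  have e023 := (derivation_triple D _ _ _).trans (triple_add_smul _ _ _ h0' h2 h3)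
  have e123 := (derivation_triple D _ _ _).trans (triple_add_smul _ _ _ h1 h2 h3)
  have e014 : D (triple (v 0) (v 1) (v 4))
      = (B.trace + 0 + c₂ + c₅ + q * triple (v 0) (v 1) (v 2))
          * triple (v 0) (v 1) (v 4) := by
    rw [derivation_triple, h4', hadd, ← add_assoc, triple_add_smul _ _ _ h0' h1 rfl]
    simp only [triple, Pi.add_apply, Pi.smul_apply, smul_eq_mul]; ring
  have e024 : D (triple (v 0) (v 2) (v 4))
      = (B.trace + 0 + c₃ + c₅) * triple (v 0) (v 2) (v 4) := by
    rw [derivation_triple, h4', hadd, ← add_assoc, triple_add_smul _ _ _ h0' h2 rfl]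
    simp only [triple, Pi.add_apply, Pi.smul_apply, smul_eq_mul]; ring
  -- The left side is the total eigenvalue of `D` on the product, which is nonzero and killed by
  -- `D`.
  have hw : 6 * B.trace + 4 * c₂ + 4 * c₃ + 3 * c₄ + 2 * c₅
      + q * triple (v 0) (v 1) (v 2) = 0 := by
    apply mul_left_cancel₀ hv.ne_zero
    rw [mul_zero, ← hD]
    simp only [tripleProd, Derivation.leibniz, smul_eq_mul, e012, e013, e023, e123, e014, e024]
    generalize triple (v 0) (v 1) (v 2) = f₁
    generalize triple (v 0) (v 1) (v 3) = f₂
    generalize triple (v 0) (v 2) (v 3) = f₃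
    generalize triple (v 1) (v 2) (v 3) = f₄
    generalize triple (v 0) (v 1) (v 4) = f₅
    generalize triple (v 0) (v 2) (v 4) = f₆
    ring
  refine ⟨![B 0 0, B 0 1, B 0 2, B 1 0, B 1 1, B 1 2, B 2 0, B 2 1, B 2 2, c₂, c₃, c₄, p, q], ?_⟩
  obtain ⟨c, hc⟩ : ∃ c, c = ![B 0 0, B 0 1, B 0 2, B 1 0, B 1 1, B 1 2, B 2 0, B 2 1, B 2 2,
    c₂, c₃, c₄, p, q] := ⟨_, rfl⟩
  have hB : paramMatrix c = B := by
    subst hc; exact (Matrix.eta_fin_three B).symm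
  have hc9 : c 9 = c₂ := by rw [hc]; rfl
  have hc10 : c 10 = c₃ := by rw [hc]; rfl
  have hc11 : c 11 = c₄ := by rw [hc]; rfl
  have hc12 : c 12 = p := by rw [hc]; rfl
  have hc13 : c 13 = q := by rw [hc]; rfl
  rw [← hc]
  have hc₅ : -h * (6 * B.trace + 4 * c₂ + 4 * c₃ + 3 * c₄ + q * triple (v 0) (v 1) (v 2))
      = c₅ := by
    linear_combination -h * hw + c₅ * hh
  intro i
  fin_cases i <;> simp [logField, hB, hc9, hc10, hc11, hc12, hc13, h0, h1, h2, h3, h4, ← hc₅]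

theorem eq_zero_of_logField_eq_zero {h : R} {v : Fin 5 → Fin 3 → R}
    (hv : IsGenericColumns v) {c : Fin 14 → R} (hc : ∀ i, logField h v c i = 0) : c = 0 := by
  have hne := hv.ne_zero
  simp only [tripleProd, mul_ne_zero_iff] at hne
  obtain ⟨⟨⟨⟨⟨n₁, n₂⟩, n₃⟩, n₄⟩, n₅⟩, n₆⟩ := hne
  have h0 (r) : (paramMatrix c *ᵥ v 0) r = 0 := by simpa [logField] using congrFun (hc 0) r
  have h1 (r) : (paramMatrix c *ᵥ v 1) r + c 9 * v 1 r = 0 := by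
    simpa [logField] using congrFun (hc 1) r
  have h2 (r) : (paramMatrix c *ᵥ v 2) r + c 10 * v 2 r = 0 := by
    simpa [logField] using congrFun (hc 2) r
  have h3 (r) : (paramMatrix c *ᵥ v 3) r + c 11 * v 3 r = 0 := by
    simpa [logField] using congrFun (hc 3) r
  obtain ⟨B, hB⟩ : ∃ B, B = paramMatrix c := ⟨_, rfl⟩
  rw [← hB] at h0 h1 h2 h3
  have hr (r) : triple (v 0) (v 1) (v 2) * v 3 r = triple (v 1) (v 2) (v 3) * v 0 r
      - triple (v 0) (v 2) (v 3) * v 1 r + triple (v 0) (v 1) (v 3) * v 2 r := by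
    rw [triple_mul_apply]; simp only [triple]; ring
  have hBr (r) : triple (v 0) (v 1) (v 2) * (B *ᵥ v 3) r
      = triple (v 1) (v 2) (v 3) * (B *ᵥ v 0) r
      - triple (v 0) (v 2) (v 3) * (B *ᵥ v 1) r + triple (v 0) (v 1) (v 3) * (B *ᵥ v 2) r := by
    simp only [mulVec_three]
    linear_combination B r 0 * hr 0 + B r 1 * hr 1 + B r 2 * hr 2
  -- The columns are eigenvectors of `B`, with eigenvalue 0 on `v 0`. Applying `B` to the relation
  -- between four columns leaves a relation between three independent ones, so all the eigenvalues
  -- vanish.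
  have key (r) : (c 11 * triple (v 1) (v 2) (v 3)) * v 0 r
      + ((c 9 - c 11) * triple (v 0) (v 2) (v 3)) * v 1 r
      + ((c 11 - c 10) * triple (v 0) (v 1) (v 3)) * v 2 r = 0 := by
    linear_combination (-c 11) * hr r - hBr r + triple (v 0) (v 1) (v 2) * h3 r
      - triple (v 1) (v 2) (v 3) * h0 r + triple (v 0) (v 2) (v 3) * h1 r
      - triple (v 0) (v 1) (v 3) * h2 r
  have ind {x y z : R} (a b d : Fin 3 → R) (hz : ∀ r, x * a r + y * b r + z * d r = 0)
      (hn : triple a b d ≠ 0) : x = 0 ∧ y = 0 ∧ z = 0 := by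
    have k0 := hz 0
    have k1 := hz 1
    have k2 := hz 2
    refine ⟨?_, ?_, ?_⟩ <;> apply mul_right_cancel₀ hn <;> simp only [triple]
    · linear_combination (b 1 * d 2 - b 2 * d 1) * k0 - (b 0 * d 2 - b 2 * d 0) * k1
        + (b 0 * d 1 - b 1 * d 0) * k2
    · linear_combination -(a 1 * d 2 - a 2 * d 1) * k0 + (a 0 * d 2 - a 2 * d 0) * k1
        - (a 0 * d 1 - a 1 * d 0) * k2
    · linear_combination (a 1 * b 2 - a 2 * b 1) * k0 - (a 0 * b 2 - a 2 * b 0) * k1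
        + (a 0 * b 1 - a 1 * b 0) * k2
  obtain ⟨k0, k1, k2⟩ := ind _ _ _ key n₁
  have hc11 : c 11 = 0 := (mul_eq_zero.mp k0).resolve_right n₄
  have hc9 : c 9 = 0 := by
    have := (mul_eq_zero.mp k1).resolve_right n₃
    linear_combination this + hc11
  have hc10 : c 10 = 0 := by
    have := (mul_eq_zero.mp k2).resolve_right n₂
    linear_combination hc11 - this
  have hB0 : B = 0 := by
    have e0 (r) := h0 r
    have e1 (r) := h1 r
    have e2 (r) := h2 r
    simp only [mulVec_three, hc9, hc10, zero_mul, add_zero] at e0 e1 e2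
    have hrow (r) : B r 0 = 0 ∧ B r 1 = 0 ∧ B r 2 = 0 := by
      have p0 := e0 r
      have p1 := e1 r
      have p2 := e2 r
      have hd := n₁
      generalize v 0 = a at *
      generalize v 1 = b at *
      generalize v 2 = d at *
      refine ⟨?_, ?_, ?_⟩ <;> apply mul_right_cancel₀ hd <;> simp only [triple]
      · linear_combination (b 1 * d 2 - b 2 * d 1) * p0 - (a 1 * d 2 - a 2 * d 1) * p1
          + (a 1 * b 2 - a 2 * b 1) * p2
      · linear_combination -(b 0 * d 2 - b 2 * d 0) * p0 + (a 0 * d 2 - a 2 * d 0) * p1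
          - (a 0 * b 2 - a 2 * b 0) * p2
      · linear_combination (b 0 * d 1 - b 1 * d 0) * p0 - (a 0 * d 1 - a 1 * d 0) * p1
          + (a 0 * b 1 - a 1 * b 0) * p2
    ext r s
    fin_cases s
    exacts [(hrow r).1, (hrow r).2.1, (hrow r).2.2]
  have h4 (r) : c 12 * v 0 r + (c 13 * triple (v 0) (v 1) (v 4)) * v 2 r
      + (-h * (c 13 * triple (v 0) (v 1) (v 2))) * v 4 r = 0 := by
    have := congrFun (hc 4) r
    simp only [logField, ← hB, hB0, hc9, hc10, hc11] at this
    simpa using this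
  obtain ⟨j0, j1, -⟩ := ind _ _ _ h4 n₆
  have hc13 : c 13 = 0 := (mul_eq_zero.mp j1).resolve_right n₅
  have hBc (r s) : paramMatrix c r s = 0 := by rw [← hB, hB0]; rfl
  funext i
  fin_cases i
  exacts [hBc 0 0, hBc 0 1, hBc 0 2, hBc 1 0, hBc 1 1, hBc 1 2, hBc 2 0, hBc 2 1, hBc 2 2,
    hc9, hc10, hc11, j0, hc13]

end LogFieldDomain

/-! ### Irreducibility and coprimality of the minors; reduction to one product -/

section Minors

variable {K : Type*} [Field K]

theorem not_dvd_of_eval {σ : Type*} {p q : MvPolynomial σ K} (x : σ → K) (hp : eval x p = 0)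
    (hq : eval x q ≠ 0) : ¬ p ∣ q := by
  rintro ⟨s, rfl⟩
  exact hq (by rw [map_mul, hp, zero_mul])

variable (K) in
/-- The columns of the generic matrix, permuted by `e`. -/
noncomputable def column (e : Equiv.Perm (Fin 5)) (i : Fin 5) (r : Fin 3) : MvPolynomial Var K := X (r, e i)

theorem minor_eq_triple (i j k : Fin 5) :
    minor K i j k = triple (column K 1 i) (column K 1 j) (column K 1 k) := by
  simp only [minor, genericMatrix, Matrix.det_fin_three, triple, column]
  simp
  ring

theorem isHomogeneous_column (e : Equiv.Perm (Fin 5)) (i : Fin 5) (r : Fin 3) :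
    (column K e i r).IsHomogeneous 1 := isHomogeneous_X _ _

theorem isHomogeneous_triple (e : Equiv.Perm (Fin 5)) (i j k : Fin 5) :
    (triple (column K e i) (column K e j) (column K e k)).IsHomogeneous 3 := by
  have h (a b c d : Fin 3) : (column K e j a * column K e k b
      - column K e j c * column K e k d).IsHomogeneous 2 :=
    ((isHomogeneous_column e j a).mul (isHomogeneous_column e k b)).sub
      ((isHomogeneous_column e j c).mul (isHomogeneous_column e k d))
  exact (((isHomogeneous_column e i 0).mul (h _ _ _ _)).sub
    ((isHomogeneous_column e i 1).mul (h _ _ _ _))).add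
    ((isHomogeneous_column e i 2).mul (h _ _ _ _))

theorem irreducible_minor_two {σ : Type*} {a b c d : σ} (hb : b ≠ a) (hc : c ≠ a) (hd : d ≠ a)
    (hcb : c ≠ b) (hdb : d ≠ b) :
    Irreducible (X b * X a - X c * X d : MvPolynomial σ K) := by
  classical
  rw [sub_eq_add_neg]
  apply irreducible_mul_X_add
  · exact X_ne_zero _
  · simp [vars_X, hb.symm]
  · rw [vars_neg]
    intro h
    have := vars_mul _ _ h
    simp [vars_X, hc.symm, hd.symm] at this
  · rw [(X_prime (R := K) (i := b)).irreducible.isRelPrime_iff_not_dvd]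
    exact not_dvd_of_eval (Function.update 1 b 0) (by simp) (by simp [hcb, hdb])

/-- The minor has degree one in `X (0, e i)`, and its leading coefficient is an irreducible 2-minor
that does not divide the rest. -/
theorem irreducible_triple {e : Equiv.Perm (Fin 5)} {i j k : Fin 5} (hij : i ≠ j) (hik : i ≠ k)
    (hjk : j ≠ k) : Irreducible (triple (column K e i) (column K e j) (column K e k)) := by
  classical
  have h : triple (column K e i) (column K e j) (column K e k)
      = (X (2, e k) * X (1, e j) - X (2, e j) * X (1, e k)) * X (0, e i)
        + (X (1, e i) * (X (2, e j) * X (0, e k) - X (0, e j) * X (2, e k))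
          + X (2, e i) * (X (0, e j) * X (1, e k) - X (1, e j) * X (0, e k))) := by
    simp only [triple, column]; ring
  have hirr : Irreducible
      (X (2, e k) * X (1, e j) - X (2, e j) * X (1, e k) : MvPolynomial Var K) := by
    apply irreducible_minor_two <;> simp [hjk, hjk.symm]
  rw [h]
  have hX {v : Var} (hv : v ≠ (0, e i)) :
      (X v : MvPolynomial Var K) ∈ supported K ({(0, e i)}ᶜ : Set Var) := X_mem_supported.2 hv
  have hS {p : MvPolynomial Var K} (hp : p ∈ supported K ({(0, e i)}ᶜ : Set Var)) :
      (0, e i) ∉ p.vars := fun hmem => mem_supported.1 hp hmem rfl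
  apply irreducible_mul_X_add
  · exact hirr.ne_zero
  · apply hS
    refine sub_mem (mul_mem (hX ?_) (hX ?_)) (mul_mem (hX ?_) (hX ?_)) <;> simp
  · apply hS
    refine add_mem (mul_mem (hX ?_) (sub_mem (mul_mem (hX ?_) (hX ?_)) (mul_mem (hX ?_) (hX ?_))))
      (mul_mem (hX ?_) (sub_mem (mul_mem (hX ?_) (hX ?_)) (mul_mem (hX ?_) (hX ?_)))) <;>
      simp [hij.symm, hik.symm]
  · rw [hirr.isRelPrime_iff_not_dvd]
    -- At this point columns `i, j, k` are the unit vectors 1, 0, 2, so the 2-minor in rows 1, 2 of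
    -- columns `j, k` vanishes and the rest is -1.
    apply not_dvd_of_eval fun v =>
      if v = (0, e j) ∨ v = (1, e i) ∨ v = (2, e k) then (1 : K) else 0
    · simp [hjk, hij.symm, hik.symm, hjk.symm]
    · simp [hij, hik, hjk, hij.symm, hik.symm, hjk.symm]

theorem isRelPrime_triple {e : Equiv.Perm (Fin 5)} {i j k i' j' k' : Fin 5}
    (h : i ≠ j ∧ i ≠ k ∧ j ≠ k ∧ i' ≠ j' ∧ i' ≠ k' ∧ j' ≠ k' ∧ ∃ l ∈ [i, j, k], l ∉ [i', j', k']) :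
    IsRelPrime (triple (column K e i) (column K e j) (column K e k))
      (triple (column K e i') (column K e j') (column K e k')) := by
  obtain ⟨hij, hik, hjk, hij', hik', hjk', l, hl, hl'⟩ := h
  rw [(irreducible_triple hij hik hjk).isRelPrime_iff_not_dvd]
  simp only [List.mem_cons, List.not_mem_nil, or_false, not_or] at hl hl'
  obtain ⟨h1, h2, h3⟩ := hl'
  -- Columns `i', j', k'` form the identity and all others vanish, among them column `l` of the
  -- first minor.
  apply not_dvd_of_eval fun v =>
    if v = (0, e i') ∨ v = (1, e j') ∨ v = (2, e k') then (1 : K) else 0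
  · rcases hl with rfl | rfl | rfl <;> simp [triple, column, h1, h2, h3]
  · simp [triple, column, hij', hik', hjk', hij'.symm, hik'.symm, hjk'.symm]

theorem isGenericColumns (e : Equiv.Perm (Fin 5)) : IsGenericColumns (column K e) where
  ne_zero := by
    simp only [tripleProd, mul_ne_zero_iff]
    refine ⟨⟨⟨⟨⟨?_, ?_⟩, ?_⟩, ?_⟩, ?_⟩, ?_⟩ <;>
      exact (irreducible_triple (by decide) (by decide) (by decide)).ne_zero
  relPrime₁ := by
    simp only [IsRelPrime.mul_right_iff]
    refine ⟨⟨⟨⟨?_, ?_⟩, ?_⟩, ?_⟩, ?_⟩ <;> exact isRelPrime_triple (by decide)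
  relPrime₂ := by
    simp only [IsRelPrime.mul_right_iff]
    refine ⟨⟨⟨⟨?_, ?_⟩, ?_⟩, ?_⟩, ?_⟩ <;> exact isRelPrime_triple (by decide)
  relPrime₃ := by
    simp only [IsRelPrime.mul_right_iff]
    refine ⟨⟨⟨⟨?_, ?_⟩, ?_⟩, ?_⟩, ?_⟩ <;> exact isRelPrime_triple (by decide)
  relPrime₄ := by
    simp only [IsRelPrime.mul_right_iff]
    refine ⟨⟨⟨⟨?_, ?_⟩, ?_⟩, ?_⟩, ?_⟩ <;> exact isRelPrime_triple (by decide)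
  relPrime₅ := by
    simp only [IsRelPrime.mul_right_iff]
    refine ⟨⟨⟨⟨?_, ?_⟩, ?_⟩, ?_⟩, ?_⟩ <;> exact isRelPrime_triple (by decide)
  relPrime₆ := by
    simp only [IsRelPrime.mul_right_iff]
    refine ⟨⟨⟨⟨?_, ?_⟩, ?_⟩, ?_⟩, ?_⟩ <;> exact isRelPrime_triple (by decide)

/-- The columns of the minors `f 1`, …, `f 9`, counted from zero. -/
def minorColumns : ℕ → Fin 3 → Fin 5
  | 1 => ![0, 1, 2]
  | 2 => ![0, 1, 3]
  | 3 => ![0, 2, 3]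
  | 4 => ![1, 2, 3]
  | 5 => ![0, 1, 4]
  | 6 => ![0, 2, 4]
  | 7 => ![1, 2, 4]
  | 8 => ![0, 3, 4]
  | 9 => ![1, 3, 4]
  | _ => ![2, 3, 4]

theorem f_eq_triple {i : ℕ} (hi : i ∈ Finset.Icc 1 9) :
    f K i = triple (column K 1 (minorColumns i 0)) (column K 1 (minorColumns i 1))
      (column K 1 (minorColumns i 2)) := by
  simp only [Finset.mem_Icc] at hi
  obtain ⟨h1, h9⟩ := hi
  interval_cases i <;> exact minor_eq_triple _ _ _

theorem isArrangement_f : IsArrangement (Finset.Icc 1 9) (f K) where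
  homogeneous i hi := ⟨3, f_eq_triple (K := K) hi ▸ isHomogeneous_triple 1 _ _ _⟩
  irreducible i hi := by
    have : ∀ i ∈ Finset.Icc 1 9, minorColumns i 0 ≠ minorColumns i 1 ∧
        minorColumns i 0 ≠ minorColumns i 2 ∧ minorColumns i 1 ≠ minorColumns i 2 := by decide
    rw [f_eq_triple hi]
    exact irreducible_triple (this i hi).1 (this i hi).2.1 (this i hi).2.2
  relPrime i hi j hj hij := by
    rw [f_eq_triple hi, f_eq_triple hj]
    apply isRelPrime_triple
    revert i j
    decide

theorem IsArrangement.mono {ι σ : Type*} {s t : Finset ι} {g : ι → MvPolynomial σ K}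
    (h : IsArrangement t g) (hst : s ⊆ t) : IsArrangement s g where
  homogeneous i hi := h.homogeneous i (hst hi)
  irreducible i hi := h.irreducible i (hst hi)
  relPrime i hi j hj hij := h.relPrime i (hst hi) j (hst hj) hij

theorem squarefree_Q {k : ℕ} (hk : k ∈ Finset.Icc 6 9) : Squarefree (Q K k) := by
  have hA := isArrangement_f (K := K)
  have hm {i : ℕ} (h1 : 1 ≤ i) (h9 : i ≤ 9) : i ∈ Finset.Icc 1 9 := Finset.mem_Icc.2 ⟨h1, h9⟩
  obtain ⟨h6, h9⟩ := Finset.mem_Icc.1 hk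
  have hsq {i : ℕ} (h1 : 1 ≤ i) (h9 : i ≤ 9) : Squarefree (f K i) :=
    (hA.irreducible i (hm h1 h9)).squarefree
  have hr {i j : ℕ} (h1 : 1 ≤ i) (hij : i < j) (h9 : j ≤ 9) : IsRelPrime (f K i) (f K j) :=
    hA.relPrime i (hm h1 (hij.le.trans h9)) j (hm (h1.trans hij.le) h9) hij.ne
  simp only [Q, squarefree_mul_iff, IsRelPrime.mul_left_iff]
  refine ⟨⟨⟨⟨⟨hr ?_ ?_ ?_, hr ?_ ?_ ?_⟩, hr ?_ ?_ ?_⟩, hr ?_ ?_ ?_⟩, hr ?_ ?_ ?_⟩,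
    ⟨⟨⟨⟨hr ?_ ?_ ?_, hr ?_ ?_ ?_⟩, hr ?_ ?_ ?_⟩, hr ?_ ?_ ?_⟩, ⟨⟨⟨hr ?_ ?_ ?_, hr ?_ ?_ ?_⟩,
      hr ?_ ?_ ?_⟩, ⟨⟨hr ?_ ?_ ?_, hr ?_ ?_ ?_⟩, ⟨hr ?_ ?_ ?_, hsq ?_ ?_, hsq ?_ ?_⟩, hsq ?_ ?_⟩,
        hsq ?_ ?_⟩, hsq ?_ ?_⟩, hsq ?_ ?_⟩ <;> omega

theorem isHomogeneous_Q {k : ℕ} (hk : k ∈ Finset.Icc 6 9) : (Q K k).IsHomogeneous 18 := by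
  have h {i : ℕ} (h1 : 1 ≤ i) (h9 : i ≤ 9) : (f K i).IsHomogeneous 3 :=
    f_eq_triple (K := K) (Finset.mem_Icc.2 ⟨h1, h9⟩) ▸ isHomogeneous_triple 1 _ _ _
  obtain ⟨h6, h9⟩ := Finset.mem_Icc.1 hk
  refine (((((h ?_ ?_).mul (h ?_ ?_)).mul (h ?_ ?_)).mul (h ?_ ?_)).mul (h ?_ ?_)).mul (h ?_ h9)
    <;> omega

variable (K) in
/-- After a permutation of the columns, `Q K k` is up to sign the product `tripleProd`. -/
theorem exists_Q_eq {k : ℕ} (hk : k ∈ Finset.Icc 6 9) : ∃ e : Equiv.Perm (Fin 5),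
    Q K k = tripleProd (column K e) ∨ Q K k = -tripleProd (column K e) := by
  have hc (e : Equiv.Perm (Fin 5)) {i j : Fin 5} (h : e i = j) :
      column K e i = column K 1 j := by subst h; rfl
  obtain ⟨h6, h9⟩ := Finset.mem_Icc.1 hk
  interval_cases k
  · exact ⟨1, Or.inl (by simp only [Q, f, minor_eq_triple, tripleProd])⟩
  -- The minors 012, 013, 014 change sign, hence the total sign -1.
  · refine ⟨Equiv.swap 0 1, Or.inr ?_⟩
    simp only [Q, f, minor_eq_triple, tripleProd, hc (Equiv.swap 0 1) (i := 0) (j := 1) (by decide),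
      hc (Equiv.swap 0 1) (i := 1) (j := 0) (by decide),
      hc (Equiv.swap 0 1) (i := 2) (j := 2) (by decide),
      hc (Equiv.swap 0 1) (i := 3) (j := 3) (by decide),
      hc (Equiv.swap 0 1) (i := 4) (j := 4) (by decide),
      triple_comm_left (column K 1 0) (column K 1 1)]
    ring
  · refine ⟨Equiv.swap 2 3, Or.inl ?_⟩
    simp only [Q, f, minor_eq_triple, tripleProd, hc (Equiv.swap 2 3) (i := 0) (j := 0) (by decide),
      hc (Equiv.swap 2 3) (i := 1) (j := 1) (by decide),
      hc (Equiv.swap 2 3) (i := 2) (j := 3) (by decide),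
      hc (Equiv.swap 2 3) (i := 3) (j := 2) (by decide),
      hc (Equiv.swap 2 3) (i := 4) (j := 4) (by decide),
      triple_comm_right _ (column K 1 2) (column K 1 3)]
    ring
  · refine ⟨Equiv.swap 0 1 * Equiv.swap 2 3, Or.inr ?_⟩
    simp only [Q, f, minor_eq_triple, tripleProd,
      hc (Equiv.swap 0 1 * Equiv.swap 2 3) (i := 0) (j := 1) (by decide),
      hc (Equiv.swap 0 1 * Equiv.swap 2 3) (i := 1) (j := 0) (by decide),
      hc (Equiv.swap 0 1 * Equiv.swap 2 3) (i := 2) (j := 3) (by decide),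
      hc (Equiv.swap 0 1 * Equiv.swap 2 3) (i := 3) (j := 2) (by decide),
      hc (Equiv.swap 0 1 * Equiv.swap 2 3) (i := 4) (j := 4) (by decide),
      triple_comm_left (column K 1 0) (column K 1 1),
      triple_comm_right _ (column K 1 2) (column K 1 3)]
    ring

end Minors

/-! ### Linearity in the parameters -/

section LinearMap

variable {R : Type*} [CommRing R]

theorem paramMatrix_add (c d : Fin 14 → R) :
    paramMatrix (c + d) = paramMatrix c + paramMatrix d := by
  ext r s
  fin_cases r <;> fin_cases s <;> rfl

theorem paramMatrix_smul (a : R) (c : Fin 14 → R) :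
    paramMatrix (a • c) = a • paramMatrix c := by
  ext r s
  fin_cases r <;> fin_cases s <;> rfl

theorem logField_add (h : R) (v : Fin 5 → Fin 3 → R) (c d : Fin 14 → R) (i : Fin 5)
    (r : Fin 3) : logField h v (c + d) i r = logField h v c i r + logField h v d i r := by
  fin_cases i <;>
    simp [logField, paramMatrix_add, Matrix.add_mulVec, Matrix.trace_add] <;> ring

theorem logField_smul (h : R) (v : Fin 5 → Fin 3 → R) (a : R) (c : Fin 14 → R) (i : Fin 5)
    (r : Fin 3) : logField h v (a • c) i r = a * logField h v c i r := by
  fin_cases i <;>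
    simp [logField, paramMatrix_smul, Matrix.smul_mulVec, Matrix.trace_smul] <;> ring

end LinearMap

/-! ### The graded resolution -/

section Resolution

variable {K : Type*} [Field K]

theorem gradientMap_apply {σ : Type*} [Fintype σ] (F : MvPolynomial σ K)
    (a : σ → MvPolynomial σ K) : gradientMap F a = mkDerivation K a F := by
  classical
  have h : mkDerivation K a = ∑ v, a v • pderiv (R := K) v := by
    apply derivation_ext
    intro i
    rw [mkDerivation_X, ← Derivation.coeFnAddMonoidHom_apply, map_sum]
    simp [pderiv_X, Pi.single_apply]
  rw [h, ← Derivation.coeFnAddMonoidHom_apply, map_sum]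
  simp [gradientMap, Fintype.linearCombination_apply]

variable (K) in
/-- The map that sends parameters to the coefficients of the vector field `logField`. -/
noncomputable def logFieldMap (e : Equiv.Perm (Fin 5)) :
    (Fin 14 → MvPolynomial Var K) →ₗ[MvPolynomial Var K] (Var → MvPolynomial Var K) where
  toFun c v := logField (C 2⁻¹) (column K e) c (e.symm v.2) v.1
  map_add' _ _ := funext fun _ => logField_add _ _ _ _ _ _
  map_smul' _ _ := funext fun _ => logField_smul _ _ _ _ _ _

theorem mkDerivation_comp_column (e : Equiv.Perm (Fin 5)) (a : Var → MvPolynomial Var K)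
    (i : Fin 5) : mkDerivation K a ∘ column K e i = fun r => a (r, e i) := by
  funext r
  simp [column]

/-- Parameter 13 always occurs multiplied by a cubic minor, so it is constrained only through such
products. This covers `n = 3` with only parameter 13 nonzero and `n = 0` with parameter 13 zero. -/
theorem isHomogeneous_logField {n : ℕ} {c : Fin 14 → MvPolynomial Var K}
    (hc : ∀ i, i ≠ 13 → (c i).IsHomogeneous n)
    (hc' : ∀ g : MvPolynomial Var K, g.IsHomogeneous 3 → (c 13 * g).IsHomogeneous n)
    (h : K) (e : Equiv.Perm (Fin 5)) (i : Fin 5) (r : Fin 3) :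
    (logField (C h) (column K e) c i r).IsHomogeneous (n + 1) := by
  have hB (r s : Fin 3) : (paramMatrix c r s).IsHomogeneous n := by
    fin_cases r <;> fin_cases s <;> exact hc _ (by decide)
  have hmul (i) : ((paramMatrix c *ᵥ column K e i) r).IsHomogeneous (n + 1) := by
    rw [mulVec_three]
    exact (((hB _ _).mul (isHomogeneous_column e i 0)).add
      ((hB _ _).mul (isHomogeneous_column e i 1))).add ((hB _ _).mul (isHomogeneous_column e i 2))
  have hnum (m : ℕ) {p : MvPolynomial Var K} (hp : p.IsHomogeneous n) :
      ((m : MvPolynomial Var K) * p).IsHomogeneous n := by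
    have := (isHomogeneous_C Var (m : K)).mul hp
    rwa [zero_add, map_natCast] at this
  have htr : (paramMatrix c).trace.IsHomogeneous n := by
    rw [Matrix.trace_fin_three]
    exact ((hB _ _).add (hB _ _)).add (hB _ _)
  have hw : (-C h * (6 * (paramMatrix c).trace + 4 * c 9 + 4 * c 10 + 3 * c 11
      + c 13 * triple (column K e 0) (column K e 1) (column K e 2))).IsHomogeneous n := by
    have h1 := (((((hnum 6 htr).add (hnum 4 (hc 9 (by decide)))).add
      (hnum 4 (hc 10 (by decide)))).add (hnum 3 (hc 11 (by decide)))).add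
        (hc' _ (isHomogeneous_triple e 0 1 2)))
    have h2 := (isHomogeneous_C Var (-h)).mul h1
    rw [zero_add, map_neg] at h2
    exact_mod_cast h2
  have hcol {p : MvPolynomial Var K} (hp : p.IsHomogeneous n) (i) :
      ((p • column K e i) r).IsHomogeneous (n + 1) := hp.mul (isHomogeneous_column e i r)
  refine (hmul i).add ?_
  fin_cases i
  · exact isHomogeneous_zero _ _ _
  · exact hcol (hc 9 (by decide)) 1
  · exact hcol (hc 10 (by decide)) 2
  · exact hcol (hc 11 (by decide)) 3
  · exact ((hcol (hc 12 (by decide)) 0).add (hcol (hc' _ (isHomogeneous_triple e 0 1 4)) 2)).add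
      (hcol hw 4)

theorem isHomogeneous_logFieldMap (e : Equiv.Perm (Fin 5)) (i : Fin 14) (v : Var) :
    (logFieldMap K e (Pi.single i 1) v).IsHomogeneous (if i.val < 13 then 1 else 4) := by
  by_cases hi : i = 13
  · subst hi
    refine isHomogeneous_logField (n := 3) (fun j hj => ?_) (fun g hg => ?_) _ _ _ _
    · rw [Pi.single_eq_of_ne hj]
      exact isHomogeneous_zero _ _ _
    · rwa [Pi.single_eq_same, one_mul]
  · have hlt : i.val < 13 := by
      have := i.isLt
      have : i.val ≠ 13 := fun h => hi (Fin.ext h)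
      omega
    rw [if_pos hlt]
    refine isHomogeneous_logField (n := 0) (fun j hj => ?_) (fun g hg => ?_) _ _ _ _
    · by_cases hij : j = i
      · subst hij
        rw [Pi.single_eq_same]
        exact isHomogeneous_one _ _
      · rw [Pi.single_eq_of_ne hij]
        exact isHomogeneous_zero _ _ _
    · rw [Pi.single_eq_of_ne (Ne.symm hi), zero_mul]
      exact isHomogeneous_zero _ _ _

theorem constantCoeff_eq_zero_of_isHomogeneous {σ : Type*} {p : MvPolynomial σ K} {n : ℕ}
    (hp : p.IsHomogeneous n) (hn : n ≠ 0) : constantCoeff p = 0 := by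
  rw [constantCoeff_eq]
  exact hp.coeff_eq_zero (by simpa using hn.symm)

theorem injective_logFieldMap (e : Equiv.Perm (Fin 5)) : Function.Injective (logFieldMap K e) := by
  rw [injective_iff_map_eq_zero]
  intro c hc
  refine eq_zero_of_logField_eq_zero (isGenericColumns (K := K) e) (h := C 2⁻¹) fun i => ?_
  funext r
  simpa [logFieldMap] using congrFun hc (r, e i)

theorem exact_logFieldMap [NeZero (2 : K)] {k : ℕ} {e : Equiv.Perm (Fin 5)}
    (hQ : Q K k = tripleProd (column K e) ∨ Q K k = -tripleProd (column K e)) :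
    Function.Exact (logFieldMap K e) (gradientMap (Q K k)) := by
  have hh : 2 * C (2⁻¹ : K) = (1 : MvPolynomial Var K) := by
    rw [← map_ofNat (C (σ := Var) (R := K)) 2, ← map_mul, mul_inv_cancel₀ two_ne_zero, map_one]
  intro a
  have hiff : gradientMap (Q K k) a = 0 ↔ mkDerivation K a (tripleProd (column K e)) = 0 := by
    rw [gradientMap_apply]
    rcases hQ with h | h <;> rw [h]
    rw [map_neg, neg_eq_zero]
  rw [hiff]
  constructor
  · intro h
    obtain ⟨c, hc⟩ := exists_logField_eq _ hh (isGenericColumns e) h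
    refine ⟨c, funext fun v => ?_⟩
    have := congrFun (hc (e.symm v.2)) v.1
    rw [mkDerivation_comp_column, Equiv.apply_symm_apply] at this
    exact this.symm
  · rintro ⟨c, rfl⟩
    refine derivation_tripleProd_eq_zero _ hh (c := c) fun i => ?_
    rw [mkDerivation_comp_column]
    funext r
    simp [logFieldMap]

theorem exact_gradientMap_mkQ {σ : Type*} [Fintype σ] (F : MvPolynomial σ K) :
    Function.Exact (gradientMap F) (Submodule.mkQ (jacobianIdeal F)) := by
  rw [LinearMap.exact_iff, Submodule.ker_mkQ, gradientMap, Fintype.range_linearCombination]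
  rfl

end Resolution

end FreeArrangement

theorem theorem1p6 (K : Type*) [Field K] [CharZero K] (k : ℕ)
    (hk : k ∈ ({6, 7, 8, 9} : Finset ℕ)) :
    FreeArrangement.IsArrangement ({1, 2, 3, 4, 5, k} : Finset ℕ) (FreeArrangement.f K) ∧
      FreeArrangement.IsFreeWithExponents (FreeArrangement.Q K k)
        (fun i : Fin 14 => if i.val < 13 then 1 else 4) := by
  replace hk : k ∈ Finset.Icc 6 9 := by
    simp only [Finset.mem_insert, Finset.mem_singleton] at hk
    rw [Finset.mem_Icc]
    omega
  have hQ := FreeArrangement.isHomogeneous_Q (K := K) hk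
  obtain ⟨e, he⟩ := FreeArrangement.exists_Q_eq K hk
  refine ⟨FreeArrangement.isArrangement_f.mono ?_, by simp, FreeArrangement.squarefree_Q hk, ?_,
    18, by norm_num, hQ, FreeArrangement.logFieldMap K e, ?_⟩
  · intro i hi
    simp only [Finset.mem_insert, Finset.mem_singleton, Finset.mem_Icc] at hi hk ⊢
    omega
  · intro i j hij
    have : i.val ≤ j.val := hij
    dsimp only
    split_ifs <;> omega
  · exact
      { graded_left := fun i v => ⟨fun _ => by
          simpa using FreeArrangement.isHomogeneous_logFieldMap e i v, fun h =>
            absurd h (not_lt.2 (Nat.le_add_left _ _))⟩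
        graded_right := fun v => ⟨fun _ => hQ.pderiv, fun h => by omega⟩
        injective := FreeArrangement.injective_logFieldMap e
        exact_middle := FreeArrangement.exact_logFieldMap he
        exact_right := FreeArrangement.exact_gradientMap_mkQ _
        minimal_left := fun i v => FreeArrangement.constantCoeff_eq_zero_of_isHomogeneous
          (FreeArrangement.isHomogeneous_logFieldMap e i v) (by split_ifs <;> norm_num)
        minimal_right := fun v => FreeArrangement.constantCoeff_eq_zero_of_isHomogeneous
          hQ.pderiv (by norm_num) }
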